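/- Let $S$ be a unital inverse semigroup with unit $e$ (for each $s\in S$, $s^*$ is the unique element with $ss^*s=s$ and $s^*ss^*=s^*$), and let $A$ be a $C^*$-algebra, not necessarily unital. Let $\beta$ be an action of $S$ on $A$: for each $s\in S$ there are a closed two-sided ideal $E_s$ of $A$ and a $*$-isomorphism $\beta_s:E_{s^*}\to E_s$, with $E_e=A$ and $\beta_r\circ\beta_s=\beta_{rs}$ as partially defined maps (equal domains and equal values) for all $r,s\in S$. Let $L$ be the $*$-algebra of finite formal sums $\sum_s a_s\delta_s$ with $a_s\in E_s$, with operations extending additively $$(a_r\delta_r)(b_s\delta_s)=\beta_r(\beta_{r^*}(a_r)b_s)\,\delta_{rs},\qquad (a_s\delta_s)^*=\beta_{s^*}(a_s^*)\,\delta_{s^*}.$$ Write $r\le t$ if $r=tf$ for some idempotent $f\in S$ (then $E_r\subseteq E_t$), and let $N$ be the two-sided ideal of $L$ generated by all $a\delta_r-a\delta_t$ with $r\le t$ and $a\in E_r$. A covariant representation $(\pi,\nu,H)$ of $(A,S,\beta)$ consists of a Hilbert space $H$, a $*$-homomorphism $\pi:A\to B(H)$ and a multiplicative map $\nu$ from $S$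 to the partial isometries of $H$ such that for every $s\in S$: $\nu_s\pi(a)\nu_{s^*}=\pi(\beta_s(a))$ for all $a\in E_{s^*}$, and $\nu_s$ has initial space $\overline{\mathrm{span}}\,\pi(E_{s^*})H$ and final space $\overline{\mathrm{span}}\,\pi(E_s)H$. Put $(\pi\times\nu)\big(\sum_s a_s\delta_s\big)=\sum_s\pi(a_s)\nu_s$ on $L$. Let $\rho:L\to B(H)$ be a $*$-homomorphism, where $H$ is a Hilbert space. Then $$\rho|_N\equiv 0\iff \rho=\pi\times\nu\ \text{ for some covariant representation } (\pi,\nu,H) \text{ of } (A,S,\beta).$$ Moreover, every covariant representation $(\pi,\nu,H)$ with $\rho=\pi\times\nu$ is given by $\pi(a)=\rho(a\delta_e)$ for $a\in A$ and, for every $s\in S$ and every two-sided approximate unit $(u_\lambda)$ of $E_s$ with $\|u_\lambda\|\le 1$, $$\nu_s h=\lim_\lambda\rho(u_\lambda\delta_s)h\qquad(h\in H).$$ -/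

import Mathlib

open Filter Topology

/-- A unital inverse semigroup: a monoid in which every `s` has exactly one `s⁻¹` (written `s*` in
the literature) with `s s⁻¹ s = s` and `s⁻¹ s s⁻¹ = s⁻¹`. -/
class UnitalInverseSemigroup (S : Type*) extends Monoid S, Inv S where
  mul_inv_mul : ∀ s : S, s * s⁻¹ * s = s
  inv_mul_inv : ∀ s : S, s⁻¹ * s * s⁻¹ = s⁻¹
  inv_unique : ∀ s t : S, s * t * s = s → t * s * t = t → t = s⁻¹

namespace UnitalInverseSemigroup

variable {S : Type*} [UnitalInverseSemigroup S]

lemma inv_inv' (s : S) : (s⁻¹)⁻¹ = s :=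
  (inv_unique s⁻¹ s (inv_mul_inv s) (mul_inv_mul s)).symm

lemma inv_of_idem {f : S} (hf : f * f = f) : f⁻¹ = f :=
  (inv_unique f f (by rw [hf, hf]) (by rw [hf, hf])).symm

/-- The natural partial order: `s ≤ t` iff `s = t f` for some idempotent `f`. -/
def NatLE (s t : S) : Prop := ∃ f : S, f * f = f ∧ s = t * f

end UnitalInverseSemigroup

/-- A closed two-sided ideal of the (not necessarily unital) C⋆-algebra `A`. -/
structure ClosedIdeal (A : Type*) [NonUnitalCStarAlgebra A] extends Submodule ℂ A where
  mul_mem_left : ∀ (a : A) {x : A}, x ∈ carrier → a * x ∈ carrier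
  mul_mem_right : ∀ {x : A} (a : A), x ∈ carrier → x * a ∈ carrier
  isClosed : IsClosed carrier

namespace ClosedIdeal

variable {A : Type*} [NonUnitalCStarAlgebra A]

/-- The elements of `I` whose adjoint is in `I` form a C⋆-subalgebra. -/
def symmPart (I : ClosedIdeal A) : NonUnitalStarSubalgebra ℂ A where
  carrier := {x | x ∈ I.carrier ∧ star x ∈ I.carrier}
  add_mem' {x y} hx hy := ⟨I.add_mem' hx.1 hy.1, by
    rw [star_add]; exact I.add_mem' hx.2 hy.2⟩
  zero_mem' := ⟨I.zero_mem', by rw [star_zero]; exact I.zero_mem'⟩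
  mul_mem' {x y} hx hy := ⟨I.mul_mem_left x hy.1, by
    rw [star_mul]; exact I.mul_mem_left _ hx.2⟩
  smul_mem' c {x} hx := ⟨I.smul_mem' c hx.1, by
    rw [star_smul]; exact I.smul_mem' _ hx.2⟩
  star_mem' {x} hx := ⟨hx.2, by rw [star_star]; exact hx.1⟩

lemma isClosed_symmPart (I : ClosedIdeal A) : IsClosed (I.symmPart : Set A) :=
  I.isClosed.inter (I.isClosed.preimage continuous_star)

/-- A closed two-sided ideal of a C⋆-algebra is self-adjoint. -/
lemma star_mem (I : ClosedIdeal A) {a : A} (ha : a ∈ I.carrier) : star a ∈ I.carrier := by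
  have : IsClosed (I.symmPart : Set A) := I.isClosed_symmPart
  let _ : PartialOrder I.symmPart := CStarAlgebra.spectralOrder _
  have : StarOrderedRing I.symmPart := CStarAlgebra.spectralOrderedRing _
  have hl := CStarAlgebra.increasingApproximateUnit I.symmPart
  have hne : (CStarAlgebra.approximateUnit I.symmPart).NeBot := hl.neBot
  have hb : a * star a ∈ I.symmPart := by
    refine ⟨I.mul_mem_right _ ha, ?_⟩
    rw [star_mul, star_star]
    exact I.mul_mem_right _ ha
  have h1 : Tendsto (fun u : I.symmPart => a * star a * (u : A))
      (CStarAlgebra.approximateUnit I.symmPart) (𝓝 (a * star a)) :=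
    (continuous_subtype_val.tendsto _).comp (hl.tendsto_mul_left ⟨_, hb⟩)
  have h2 : Tendsto (fun u : I.symmPart => 2 * ‖a * star a - a * star a * (u : A)‖)
      (CStarAlgebra.approximateUnit I.symmPart) (𝓝 0) := by
    have := ((tendsto_const_nhds (x := a * star a)).sub h1).norm.const_mul 2
    simpa using this
  have h3 : Tendsto (fun u : I.symmPart => ‖star a - star a * (u : A)‖ ^ 2)
      (CStarAlgebra.approximateUnit I.symmPart) (𝓝 0) := by
    refine tendsto_of_tendsto_of_tendsto_of_le_of_le' tendsto_const_nhds h2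
      (Eventually.of_forall fun u => by positivity) ?_
    filter_upwards [hl.eventually_norm, hl.eventually_isSelfAdjoint] with u hu hsa
    have hsa' : star (u : A) = u := congrArg Subtype.val hsa.star_eq
    have hu' : ‖(u : A)‖ ≤ 1 := hu
    have key : star (star a - star a * (u : A)) * (star a - star a * (u : A))
        = (a * star a - a * star a * u) - u * (a * star a - a * star a * u) := by
      simp only [star_sub, star_mul, star_star, hsa']
      noncomm_ring
    rw [sq, ← CStarRing.norm_star_mul_self, key]
    calc _ ≤ ‖a * star a - a * star a * (u : A)‖
          + ‖(u : A)‖ * ‖a * star a - a * star a * (u : A)‖ :=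
          (norm_sub_le _ _).trans (by gcongr; exact norm_mul_le _ _)
      _ ≤ 2 * ‖a * star a - a * star a * (u : A)‖ := by
          nlinarith [norm_nonneg (a * star a - a * star a * (u : A))]
  have h4 : Tendsto (fun u : I.symmPart => ‖star a - star a * (u : A)‖)
      (CStarAlgebra.approximateUnit I.symmPart) (𝓝 0) := by
    have := h3.sqrt
    simpa [Real.sqrt_sq (norm_nonneg _)] using this
  have h5 : Tendsto (fun u : I.symmPart => star a * (u : A))
      (CStarAlgebra.approximateUnit I.symmPart) (𝓝 (star a)) := by
    rw [tendsto_iff_norm_sub_tendsto_zero]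
    simpa [norm_sub_rev] using h4
  exact I.isClosed.mem_of_tendsto h5
    (Eventually.of_forall fun u => I.mul_mem_left _ u.2.1)

/-- A closed ideal, regarded as the C⋆-algebra that it is. -/
def toStarSubalgebra (I : ClosedIdeal A) : NonUnitalStarSubalgebra ℂ A where
  toNonUnitalSubalgebra :=
    { I.toSubmodule with mul_mem' := fun {x _} _ hy => I.mul_mem_left x hy }
  star_mem' := fun ha => I.star_mem ha

end ClosedIdeal

/-- An action `β` of the unital inverse semigroup `S` on the C⋆-algebra `A`: closed ideals `E s` and
⋆-isomorphisms `β s : E s⁻¹ → E s` with `E 1 = A` and `β r ∘ β s = β (r s)` as partially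
defined maps; the two sides of the last equation have the same domain (`mem_dom_mul`) and
the same values on it (`apply_apply`). -/
structure InvAction (S A : Type*) [UnitalInverseSemigroup S] [NonUnitalCStarAlgebra A] where
  ideal : S → ClosedIdeal A
  β : ∀ s : S, (ideal s⁻¹).toStarSubalgebra ≃⋆ₐ[ℂ] (ideal s).toStarSubalgebra
  mem_one : ∀ a : A, a ∈ (ideal 1).toStarSubalgebra
  mem_dom_mul : ∀ (r s : S) (a : A), a ∈ (ideal (r * s)⁻¹).toStarSubalgebra ↔
    ∃ h : a ∈ (ideal s⁻¹).toStarSubalgebra, (β s ⟨a, h⟩ : A) ∈ (ideal r⁻¹).toStarSubalgebra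
  apply_apply : ∀ (r s : S) (a : A) (h : a ∈ (ideal s⁻¹).toStarSubalgebra)
    (h' : (β s ⟨a, h⟩ : A) ∈ (ideal r⁻¹).toStarSubalgebra)
    (h'' : a ∈ (ideal (r * s)⁻¹).toStarSubalgebra),
    (β r ⟨β s ⟨a, h⟩, h'⟩ : A) = β (r * s) ⟨a, h''⟩

namespace InvAction

open UnitalInverseSemigroup

variable {S A : Type*} [UnitalInverseSemigroup S] [NonUnitalCStarAlgebra A]

/-- The ideal `E s`, as a C⋆-algebra. -/
abbrev E (𝔅 : InvAction S A) (s : S) : NonUnitalStarSubalgebra ℂ A :=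
  (𝔅.ideal s).toStarSubalgebra

variable (𝔅 : InvAction S A)

lemma mul_mem_E (s : S) {x : A} (hx : x ∈ 𝔅.E s) (a : A) : x * a ∈ 𝔅.E s :=
  (𝔅.ideal s).mul_mem_right a hx

lemma mem_E_mul {r s : S} {y : A} (hr : y ∈ 𝔅.E r⁻¹) (hs : y ∈ 𝔅.E s) :
    (𝔅.β r ⟨y, hr⟩ : A) ∈ 𝔅.E (r * s) := by
  obtain ⟨x, hx⟩ := (𝔅.β s).surjective ⟨y, hs⟩
  have hxy : (𝔅.β s ⟨x, x.2⟩ : A) = y := congrArg Subtype.val hx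
  have h1 : (𝔅.β s ⟨x, x.2⟩ : A) ∈ 𝔅.E r⁻¹ := by rw [hxy]; exact hr
  have h2 : (x : A) ∈ 𝔅.E (r * s)⁻¹ := (𝔅.mem_dom_mul r s x).2 ⟨x.2, h1⟩
  have h3 := 𝔅.apply_apply r s x x.2 h1 h2
  have h4 : (⟨(𝔅.β s ⟨x, x.2⟩ : A), h1⟩ : 𝔅.E r⁻¹) = ⟨y, hr⟩ := Subtype.ext hxy
  rw [h4] at h3
  rw [h3]
  exact (𝔅.β (r * s) ⟨x, h2⟩).2

/-- `E (s t) ⊆ E s`. -/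
lemma E_mul_le (s t : S) {y : A} (hy : y ∈ 𝔅.E (s * t)) : y ∈ 𝔅.E s := by
  obtain ⟨x, hx⟩ := (𝔅.β (s * t)).surjective ⟨y, hy⟩
  obtain ⟨h1, h2⟩ := (𝔅.mem_dom_mul s t x).1 x.2
  have h3 := 𝔅.apply_apply s t x h1 h2 x.2
  have h4 : (𝔅.β (s * t) ⟨x, x.2⟩ : A) = y := congrArg Subtype.val hx
  rw [h4] at h3
  rw [← h3]
  exact (𝔅.β s _).2

/-- `r ≤ t` implies `E r ⊆ E t`. -/
lemma E_mono {r t : S} (h : NatLE r t) {a : A} (ha : a ∈ 𝔅.E r) : a ∈ 𝔅.E t := by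
  obtain ⟨f, -, rfl⟩ := h
  exact 𝔅.E_mul_le t f ha

/-- `β` of an idempotent is the identity. -/
lemma β_idem {f : S} (hf : f * f = f) (a : A) (ha : a ∈ 𝔅.E f⁻¹) : (𝔅.β f ⟨a, ha⟩ : A) = a := by
  have h0 : a ∈ 𝔅.E (f * f)⁻¹ := by rw [hf]; exact ha
  obtain ⟨h1, h2⟩ := (𝔅.mem_dom_mul f f a).1 h0
  have h3 := 𝔅.apply_apply f f a h1 h2 h0
  have h5 : ∀ (g : S) (_ : g = f) (hg : a ∈ 𝔅.E g⁻¹), (𝔅.β g ⟨a, hg⟩ : A) = 𝔅.β f ⟨a, ha⟩ := by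
    rintro g rfl hg; rfl
  rw [h5 _ hf h0] at h3
  have h6 := (𝔅.β f).injective (Subtype.ext h3)
  exact congrArg Subtype.val h6

/-- `β s⁻¹` is the inverse of `β s`, so that `β s⁻¹` may be written `(β s).symm` below. -/
lemma β_inv_apply (s : S) (a : A) (h : a ∈ 𝔅.E (s⁻¹)⁻¹) (h' : a ∈ 𝔅.E s) :
    (𝔅.β s⁻¹ ⟨a, h⟩ : A) = (𝔅.β s).symm ⟨a, h'⟩ := by
  have hb : (𝔅.β s⁻¹ ⟨a, h⟩ : A) ∈ 𝔅.E s⁻¹ := (𝔅.β s⁻¹ ⟨a, h⟩).2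
  have h0 : a ∈ 𝔅.E (s * s⁻¹)⁻¹ := (𝔅.mem_dom_mul s s⁻¹ a).2 ⟨h, hb⟩
  have h1 := 𝔅.apply_apply s s⁻¹ a h hb h0
  rw [𝔅.β_idem (by rw [← mul_assoc, mul_inv_mul]) a h0] at h1
  have h2 : 𝔅.β s ⟨(𝔅.β s⁻¹ ⟨a, h⟩ : A), hb⟩ = ⟨a, h'⟩ := Subtype.ext h1
  rw [← h2, StarAlgEquiv.symm_apply_apply]

open scoped DirectSum

/-- The space `L` of finite formal sums `∑ a_s δ_s` with `a_s ∈ E s`. -/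
def L (𝔅 : InvAction S A) : Type _ := ⨁ s : S, 𝔅.E s

noncomputable instance : AddCommGroup 𝔅.L := inferInstanceAs (AddCommGroup (⨁ s : S, 𝔅.E s))

noncomputable instance : Module ℂ 𝔅.L := inferInstanceAs (Module ℂ (⨁ s : S, 𝔅.E s))

open Classical in
/-- The element `a δ_s`, for `a ∈ E s`. -/
noncomputable def δ (s : S) : 𝔅.E s →ₗ[ℂ] 𝔅.L := DirectSum.lof ℂ S (fun s => 𝔅.E s) s

open Classical in
/-- The linear map on `L` that takes the values `φ s a` at `a δ_s`. -/
noncomputable def lift {M : Type*} [AddCommMonoid M] [Module ℂ M] (φ : ∀ s, 𝔅.E s →ₗ[ℂ] M) :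
    𝔅.L →ₗ[ℂ] M := DirectSum.toModule ℂ S M φ

/-- The coefficient `β_r (β_{r⁻¹} (a) b) ∈ E (r s)` of `(a δ_r) (b δ_s)`. -/
def mulCoeff (r s : S) (a : 𝔅.E r) (b : 𝔅.E s) : 𝔅.E (r * s) :=
  ⟨𝔅.β r ⟨(𝔅.β r).symm a * b, 𝔅.mul_mem_E r⁻¹ ((𝔅.β r).symm a).2 b⟩,
    𝔅.mem_E_mul _ ((𝔅.ideal s).mul_mem_left _ b.2)⟩

/-- `(a δ_r) (b δ_s)` as a bilinear function of `a ∈ E r` and `b ∈ E s`. -/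
noncomputable def mulδ (r s : S) : 𝔅.E r →ₗ[ℂ] 𝔅.E s →ₗ[ℂ] 𝔅.L :=
  LinearMap.mk₂ ℂ (fun a b => 𝔅.δ (r * s) (𝔅.mulCoeff r s a b))
    (fun a a' b => by
      rw [← map_add]; congr 1; apply Subtype.ext
      change (𝔅.β r _ : A) = (𝔅.β r _ + 𝔅.β r _ : 𝔅.E r)
      rw [← map_add]
      congr 2; apply Subtype.ext; simp [add_mul])
    (fun c a b => by
      rw [← map_smul]; congr 1; apply Subtype.ext
      change (𝔅.β r _ : A) = (c • 𝔅.β r _ : 𝔅.E r)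
      rw [← map_smul]
      congr 2; apply Subtype.ext; simp [smul_mul_assoc])
    (fun a b b' => by
      rw [← map_add]; congr 1; apply Subtype.ext
      change (𝔅.β r _ : A) = (𝔅.β r _ + 𝔅.β r _ : 𝔅.E r)
      rw [← map_add]
      congr 2; apply Subtype.ext; simp [mul_add])
    (fun c a b => by
      rw [← map_smul]; congr 1; apply Subtype.ext
      change (𝔅.β r _ : A) = (c • 𝔅.β r _ : 𝔅.E r)
      rw [← map_smul]
      congr 2; apply Subtype.ext; simp [mul_smul_comm])

/-- The multiplication of `L`: the bilinear extension of
`(a δ_r) (b δ_s) = β_r (β_{r⁻¹} (a) b) δ_{r s}`. -/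
noncomputable def mulL : 𝔅.L →ₗ[ℂ] 𝔅.L →ₗ[ℂ] 𝔅.L :=
  𝔅.lift fun r => (𝔅.lift fun s => (𝔅.mulδ r s).flip).flip

noncomputable instance : NonUnitalNonAssocRing 𝔅.L where
  __ := (inferInstance : AddCommGroup 𝔅.L)
  mul x y := 𝔅.mulL x y
  left_distrib x y z := (𝔅.mulL x).map_add y z
  right_distrib x y z := 𝔅.mulL.map_add₂ x y z
  zero_mul x := 𝔅.mulL.map_zero₂ x
  mul_zero x := (𝔅.mulL x).map_zero

/-- `(a δ_r)* = β_{r⁻¹} (a*) δ_{r⁻¹}` as an additive function of `a ∈ E r`. -/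
noncomputable def starδ (r : S) : 𝔅.E r →+ 𝔅.L :=
  AddMonoidHom.mk' (fun a => 𝔅.δ r⁻¹ ((𝔅.β r).symm (star a)))
    (fun a b => by rw [star_add, map_add, map_add])

open Classical in
/-- The involution of `L`: the additive extension of `(a δ_r)* = β_{r⁻¹} (a*) δ_{r⁻¹}`. -/
noncomputable instance : Star 𝔅.L where
  star x := DirectSum.toAddMonoid (fun r => 𝔅.starδ r) x

lemma lift_δ {M : Type*} [AddCommMonoid M] [Module ℂ M] (φ : ∀ s, 𝔅.E s →ₗ[ℂ] M)
    (s : S) (a : 𝔅.E s) : 𝔅.lift φ (𝔅.δ s a) = φ s a := by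
  classical
  exact DirectSum.toModule_lof (M := fun s => 𝔅.E s) (φ := φ) ℂ s a

lemma δ_mul_δ (r s : S) (a : 𝔅.E r) (b : 𝔅.E s) :
    𝔅.δ r a * 𝔅.δ s b = 𝔅.δ (r * s) (𝔅.mulCoeff r s a b) := by
  change 𝔅.mulL (𝔅.δ r a) (𝔅.δ s b) = _
  rw [mulL, lift_δ, LinearMap.flip_apply, lift_δ]
  rfl

lemma star_δ (r : S) (a : 𝔅.E r) : star (𝔅.δ r a) = 𝔅.δ r⁻¹ ((𝔅.β r).symm (star a)) := by
  classical
  exact DirectSum.toAddMonoid_of (fun r => 𝔅.starδ r) r a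

/-- The two-sided ideal `N` of `L` generated by the elements `a δ_r - a δ_t` with `r ≤ t` and
`a ∈ E r` (so that `a ∈ E t`). -/
noncomputable def N : TwoSidedIdeal 𝔅.L :=
  TwoSidedIdeal.span {x | ∃ (r t : S) (h : NatLE r t) (a : A) (ha : a ∈ 𝔅.E r),
    x = 𝔅.δ r ⟨a, ha⟩ - 𝔅.δ t ⟨a, 𝔅.E_mono h ha⟩}

variable {H : Type*} [NormedAddCommGroup H] [InnerProductSpace ℂ H] [CompleteSpace H]

/-- The closed linear span of the vectors `π(a) h` with `a ∈ E s` and `h ∈ H`. -/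
def essentialSpace (π : A →⋆ₙₐ[ℂ] (H →L[ℂ] H)) (s : S) : Submodule ℂ H :=
  (Submodule.span ℂ {k : H | ∃ a ∈ 𝔅.E s, ∃ h : H, k = π a h}).topologicalClosure

/-- `(π, ν, H)` is a covariant representation of `(A, S, β)`: `π` is a representation of `A` on `H`
and `ν` is a multiplicative map from `S` to the partial isometries of `H` satisfying the
covariance condition, such that `ν s` has initial space `(ker ν s)ᗮ` equal to the closed span of
`π(E s⁻¹) H` and final space `ran ν s` equal to the closed span of `π(E s) H`. -/
structure IsCovariantRep (π : A →⋆ₙₐ[ℂ] (H →L[ℂ] H)) (ν : S →ₙ* (H →L[ℂ] H)) : Prop where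
  partialIsometry : ∀ s : S, ν s * star (ν s) * ν s = ν s
  covariance : ∀ (s : S) (a : 𝔅.E s⁻¹), ν s * π (a : A) * ν s⁻¹ = π (𝔅.β s a : A)
  initialSpace : ∀ s : S, (LinearMap.ker (ν s).toLinearMap)ᗮ = 𝔅.essentialSpace π s⁻¹
  finalSpace : ∀ s : S, LinearMap.range (ν s).toLinearMap = 𝔅.essentialSpace π s

/-- The map `π × ν` on `L`, `∑ a_s δ_s ↦ ∑ π(a_s) ν_s`. -/
noncomputable def integrated (π : A →⋆ₙₐ[ℂ] (H →L[ℂ] H)) (ν : S →ₙ* (H →L[ℂ] H)) :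
    𝔅.L →ₗ[ℂ] (H →L[ℂ] H) :=
  𝔅.lift fun s =>
    { toFun := fun a => π (a : A) * ν s
      map_add' := fun a b => by rw [NonUnitalStarSubalgebra.coe_add, map_add, add_mul]
      map_smul' := fun c a => by
        rw [NonUnitalStarSubalgebra.coe_smul, map_smul, smul_mul_assoc, RingHom.id_apply] }

end InvAction

/-! If `ρ = π × ν`, take `r = t f` and `a ∈ E r`. Covariance gives `π(a) ν_t ν_f = ν_t π(b) ν_f`
with `b = β_t⁻¹(a) ∈ E f`, and `π(b)` absorbs `ν_f`; so `ρ` kills the generators of `N`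
(`mul_ν_of_natLE`). Since `ν_s h` lies in the closed span of `π(E s) H`, an approximate unit
recovers it from `ρ(u δ_s) h = π(u) ν_s h`.

Conversely, put `π(a) = ρ(a δ_1)`. Vanishing on `N` gives `ρ(a δ_f) = π(a)` for idempotent `f`,
hence `ρ(a δ_s)* ρ(b δ_s) = π(β_s⁻¹(a* b))` (`star_mul_map_δ`). So `a ↦ ρ(a δ_s)` is contractive and
its values kill the complement of the span of `π(E s⁻¹) H`. On that span `ρ(u δ_s)` converges
strongly, because `ρ(u δ_s) π(b) = ρ(u β_s(b) δ_s)`. The limits form `ν`; identities between them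
are tested after multiplication by `π(a)` (`ext_of_essentialSpace`). -/

/-! ### Strong convergence of contractive nets. -/

section StrongLimits

variable {H ι : Type*} [NormedAddCommGroup H] [InnerProductSpace ℂ H]

/-- A contractive net of operators that converges to the identity on a set does so on its closure. -/
lemma tendsto_apply_self_of_mem_closure {l : Filter ι} {T : ι → H →L[ℂ] H}
    (hT : ∀ᶠ i in l, ‖T i‖ ≤ 1) {D : Set H} (hD : ∀ h ∈ D, Tendsto (fun i => T i h) l (𝓝 h))
    {h : H} (hh : h ∈ closure D) : Tendsto (fun i => T i h) l (𝓝 h) := by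
  rw [Metric.tendsto_nhds]
  intro ε hε
  obtain ⟨k, hk, hd⟩ := Metric.mem_closure_iff.1 hh (ε / 3) (by positivity)
  filter_upwards [hT, Metric.tendsto_nhds.1 (hD k hk) (ε / 3) (by positivity)] with i hi hik
  rw [dist_eq_norm] at *
  have h1 : ‖T i (h - k)‖ ≤ 1 * ‖h - k‖ := (T i).le_of_opNorm_le hi _
  have h2 : T i h - h = T i (h - k) + (T i k - k) - (h - k) := by rw [map_sub]; abel
  have h3 : ‖T i h - h‖ ≤ ‖T i (h - k)‖ + ‖T i k - k‖ + ‖h - k‖ := by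
    rw [h2]; exact (norm_sub_le _ _).trans (by gcongr; exact norm_add_le _ _)
  linarith

/-- A contractive net of operators that converges pointwise on a set does so on its closure. -/
lemma exists_tendsto_apply_of_mem_closure [CompleteSpace H] {l : Filter ι} [l.NeBot]
    {T : ι → H →L[ℂ] H} (hT : ∀ᶠ i in l, ‖T i‖ ≤ 1) {D : Set H}
    (hD : ∀ h ∈ D, ∃ k, Tendsto (fun i => T i h) l (𝓝 k))
    {h : H} (hh : h ∈ closure D) : ∃ k, Tendsto (fun i => T i h) l (𝓝 k) := by
  rw [← cauchy_map_iff_exists_tendsto, Metric.cauchy_iff]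
  refine ⟨inferInstance, fun ε hε => ?_⟩
  obtain ⟨k, hk, hd⟩ := Metric.mem_closure_iff.1 hh (ε / 4) (by positivity)
  obtain ⟨m, hm⟩ := hD k hk
  refine ⟨Metric.ball m (ε / 2), ?_, fun x hx y hy => ?_⟩
  · rw [mem_map]
    filter_upwards [hT, Metric.tendsto_nhds.1 hm (ε / 4) (by positivity)] with i hi hik
    rw [dist_eq_norm] at *
    have h1 : ‖T i (h - k)‖ ≤ 1 * ‖h - k‖ := (T i).le_of_opNorm_le hi _
    have h2 : T i h - m = T i (h - k) + (T i k - m) := by rw [map_sub]; abel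
    have h3 : ‖T i h - m‖ ≤ ‖T i (h - k)‖ + ‖T i k - m‖ := by rw [h2]; exact norm_add_le _ _
    rw [Set.mem_preimage, mem_ball_iff_norm]
    linarith
  · have := dist_triangle_right x y m
    rw [Metric.mem_ball] at hx hy
    linarith

end StrongLimits

namespace InvAction

open UnitalInverseSemigroup

/-! ### Products and adjoints of the elements `a δ_s`. -/

section Algebra

variable {S A : Type*} [UnitalInverseSemigroup S] [NonUnitalCStarAlgebra A] (𝔅 : InvAction S A)

/-- The ideal `E s` is a C⋆-algebra. -/
noncomputable abbrev nonUnitalCStarAlgebraE (s : S) : NonUnitalCStarAlgebra (𝔅.E s) :=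
  have : IsClosed (𝔅.E s : Set A) := (𝔅.ideal s).isClosed
  inferInstance

attribute [local instance] nonUnitalCStarAlgebraE

lemma norm_β (s : S) (a : 𝔅.E s⁻¹) : ‖𝔅.β s a‖ = ‖a‖ :=
  NonUnitalStarAlgHom.norm_map (𝔅.β s) (𝔅.β s).injective a

lemma continuous_β (s : S) : Continuous (𝔅.β s) :=
  (AddMonoidHomClass.isometry_of_norm (𝔅.β s) (𝔅.norm_β s)).continuous

lemma δ_congr {s t : S} (h : s = t) {a : A} (ha : a ∈ 𝔅.E s) (hb : a ∈ 𝔅.E t) :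
    𝔅.δ s ⟨a, ha⟩ = 𝔅.δ t ⟨a, hb⟩ := by
  subst h; rfl

/-- `E (r s)` is the range of `β_r ∘ β_s`, so undoing `β_r` leaves an element of the range of `β_s`.
-/
lemma symm_mem_of_mem_mul {r s : S} {a : A} (h : a ∈ 𝔅.E (r * s)) (h' : a ∈ 𝔅.E r) :
    ((𝔅.β r).symm ⟨a, h'⟩ : A) ∈ 𝔅.E s := by
  obtain ⟨x, hx⟩ := (𝔅.β (r * s)).surjective ⟨a, h⟩
  obtain ⟨h1, h2⟩ := (𝔅.mem_dom_mul r s x).1 x.2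
  have h3 := 𝔅.apply_apply r s x h1 h2 x.2
  have h4 : (𝔅.β (r * s) ⟨x, x.2⟩ : A) = a := congrArg Subtype.val hx
  rw [h4] at h3
  have h5 : (⟨a, h'⟩ : 𝔅.E r) = 𝔅.β r ⟨_, h2⟩ := Subtype.ext h3.symm
  rw [h5, StarAlgEquiv.symm_apply_apply]
  exact (𝔅.β s _).2

lemma mem_E_mul_inv {s : S} {a : A} (ha : a ∈ 𝔅.E s) : a ∈ 𝔅.E (s * s⁻¹) :=
  𝔅.E_mul_le (s * s⁻¹) s (by rwa [mul_inv_mul])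

lemma mem_E_inv_inv {s : S} {a : A} (ha : a ∈ 𝔅.E s) : a ∈ 𝔅.E (s⁻¹)⁻¹ := by rwa [inv_inv']

lemma mem_E_of_inv_inv {s : S} {a : A} (ha : a ∈ 𝔅.E (s⁻¹)⁻¹) : a ∈ 𝔅.E s := by
  rwa [inv_inv'] at ha

lemma mem_E_inv_mul {s : S} {a : A} (ha : a ∈ 𝔅.E s⁻¹) : a ∈ 𝔅.E (s⁻¹ * s) := by
  have := 𝔅.mem_E_mul_inv ha
  rwa [inv_inv'] at this

lemma mul_inv_idem (s : S) : s * s⁻¹ * (s * s⁻¹) = s * s⁻¹ := by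
  rw [← mul_assoc, mul_inv_mul]

lemma inv_mul_idem (s : S) : s⁻¹ * s * (s⁻¹ * s) = s⁻¹ * s := by
  rw [← mul_assoc, inv_mul_inv]

lemma NatLE.one_of_idem {f : S} (hf : f * f = f) : NatLE f 1 := ⟨f, hf, (one_mul f).symm⟩

lemma mulCoeff_idem {f : S} (hf : f * f = f) (s : S) (a : 𝔅.E f) (b : 𝔅.E s) :
    (𝔅.mulCoeff f s a b : A) = a * b := by
  have h1 : ∀ c : 𝔅.E f⁻¹, (𝔅.β f c : A) = c := fun c => 𝔅.β_idem hf c c.2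
  have h2 : ((𝔅.β f).symm a : A) = a := by
    rw [← h1, StarAlgEquiv.apply_symm_apply]
  simp only [mulCoeff, h1, h2]

/-- `(a δ₁) (b δ_s) = a b δ_s`. -/
lemma δ_one_mul_δ (s : S) (a : A) (b : 𝔅.E s) :
    𝔅.δ 1 ⟨a, 𝔅.mem_one a⟩ * 𝔅.δ s b = 𝔅.δ s ⟨a * b, (𝔅.ideal s).mul_mem_left a b.2⟩ := by
  rw [δ_mul_δ]
  have h : 𝔅.mulCoeff 1 s ⟨a, 𝔅.mem_one a⟩ b =
      ⟨a * b, by rw [one_mul]; exact (𝔅.ideal s).mul_mem_left a b.2⟩ :=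
    Subtype.ext (𝔅.mulCoeff_idem (one_mul 1) s _ b)
  rw [h]
  exact 𝔅.δ_congr (one_mul s) _ _

/-- `(a δ_s) (b δ₁) = β_s (β_{s⁻¹} (a) b) δ_s`; here for `b ∈ E s⁻¹`. -/
lemma δ_mul_δ_one (s : S) (a : 𝔅.E s) (b : 𝔅.E s⁻¹) :
    𝔅.δ s a * 𝔅.δ 1 ⟨b, 𝔅.mem_one b⟩ = 𝔅.δ s (a * 𝔅.β s b) := by
  rw [δ_mul_δ]
  have h : (𝔅.mulCoeff s 1 a ⟨b, 𝔅.mem_one b⟩ : A) = (a * 𝔅.β s b : 𝔅.E s) := by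
    have : a * 𝔅.β s b = 𝔅.β s ((𝔅.β s).symm a * b) := by
      rw [map_mul, StarAlgEquiv.apply_symm_apply]
    rw [this]; rfl
  have h' : 𝔅.mulCoeff s 1 a ⟨b, 𝔅.mem_one b⟩ =
      ⟨(a * 𝔅.β s b : 𝔅.E s), by rw [mul_one]; exact Subtype.prop _⟩ := Subtype.ext h
  rw [h']
  exact 𝔅.δ_congr (mul_one s) _ _

/-- The index is idempotent, so modulo `N` this product comes from `A`. The two inner maps `β`
cancel on `star a`. -/
lemma star_δ_mul_δ (s : S) (a b : 𝔅.E s) :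
    star (𝔅.δ s a) * 𝔅.δ s b =
      𝔅.δ (s⁻¹ * s) ⟨(𝔅.β s).symm (star a * b), 𝔅.mem_E_inv_mul (Subtype.prop _)⟩ := by
  rw [star_δ, δ_mul_δ]
  congr 1
  apply Subtype.ext
  have h1 : ∀ c : 𝔅.E (s⁻¹)⁻¹, (𝔅.β s⁻¹ c : A) =
      (𝔅.β s).symm ⟨c, 𝔅.mem_E_of_inv_inv c.2⟩ :=
    fun c => 𝔅.β_inv_apply s c c.2 _
  have h2 : ((𝔅.β s⁻¹).symm ((𝔅.β s).symm (star a)) : A) = star a := by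
    have h3 : (𝔅.β s).symm (star a) = 𝔅.β s⁻¹ ⟨star a, 𝔅.mem_E_inv_inv (star a).2⟩ :=
      Subtype.ext (h1 ⟨star a, _⟩).symm
    rw [h3, StarAlgEquiv.symm_apply_apply]; rfl
  simp only [mulCoeff, h1]
  congr 2
  apply Subtype.ext
  change _ * _ = _
  rw [h2]
  rfl

end Algebra

section Covariant

variable {S A : Type*} [UnitalInverseSemigroup S] [NonUnitalCStarAlgebra A] (𝔅 : InvAction S A)
  {H : Type*} [NormedAddCommGroup H] [InnerProductSpace ℂ H] [CompleteSpace H]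

/-! ### The closed span of `π(E s) H`. -/

section EssentialSpace

variable {𝔅} (π : A →⋆ₙₐ[ℂ] (H →L[ℂ] H)) {s : S}

lemma continuous_starHom : Continuous π :=
  AddMonoidHomClass.continuous_of_bound π 1 fun a => by
    rw [one_mul]; exact NonUnitalStarAlgHom.norm_apply_le π a

lemma apply_mem_essentialSpace {a : A} (ha : a ∈ 𝔅.E s) (h : H) :
    π a h ∈ 𝔅.essentialSpace π s :=
  Submodule.le_topologicalClosure _ (Submodule.subset_span ⟨a, ha, h, rfl⟩)

lemma isClosed_essentialSpace : IsClosed (𝔅.essentialSpace π s : Set H) :=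
  Submodule.isClosed_topologicalClosure _

lemma essentialSpace_le {K : Submodule ℂ H} (hK : IsClosed (K : Set H))
    (h : ∀ a ∈ 𝔅.E s, ∀ k : H, π a k ∈ K) : 𝔅.essentialSpace π s ≤ K :=
  Submodule.topologicalClosure_minimal _
    (Submodule.span_le.2 (by rintro _ ⟨a, ha, k, rfl⟩; exact h a ha k)) hK

/-- Move `π(a)` across the inner product; `E s` is self-adjoint. -/
lemma mem_essentialSpace_orthogonal {k : H} :
    k ∈ (𝔅.essentialSpace π s)ᗮ ↔ ∀ a ∈ 𝔅.E s, π a k = 0 := by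
  constructor
  · intro hk a ha
    refine ext_inner_left ℂ fun h => ?_
    have h1 := (Submodule.mem_orthogonal _ _).1 hk _
      (apply_mem_essentialSpace π (star_mem ha) h)
    rw [map_star, ContinuousLinearMap.star_eq_adjoint,
      ContinuousLinearMap.adjoint_inner_left] at h1
    rw [h1, inner_zero_right]
  · intro hk
    rw [essentialSpace, Submodule.orthogonal_closure, Submodule.mem_orthogonal]
    intro u hu
    induction hu using Submodule.span_induction with
    | mem x hx =>
      obtain ⟨a, ha, h, rfl⟩ := hx
      have h1 := hk _ (star_mem ha)
      rw [← ContinuousLinearMap.adjoint_inner_right, ← ContinuousLinearMap.star_eq_adjoint,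
        ← map_star, h1, inner_zero_right]
    | zero => rw [inner_zero_left]
    | add x y _ _ hx hy => rw [inner_add_left, hx, hy, add_zero]
    | smul c x _ hx => rw [inner_smul_left, hx, mul_zero]

/-- Operators into the essential space of `E s` are determined by their products with `π(E s)`. -/
lemma ext_of_essentialSpace {T T' : H →L[ℂ] H} (hT : ∀ h, T h ∈ 𝔅.essentialSpace π s)
    (hT' : ∀ h, T' h ∈ 𝔅.essentialSpace π s) (h : ∀ a ∈ 𝔅.E s, π a * T = π a * T') : T = T' := by
  ext x
  rw [← sub_eq_zero]
  refine (Submodule.mem_bot ℂ).1 ?_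
  -- The difference lies in the essential space, and being killed by `π(E s)` it is also orthogonal
  -- to it.
  rw [← Submodule.inf_orthogonal_eq_bot (𝔅.essentialSpace π s)]
  refine ⟨sub_mem (hT x) (hT' x), (mem_essentialSpace_orthogonal π).2 fun a ha => ?_⟩
  rw [map_sub, sub_eq_zero]
  exact congrArg (fun T : H →L[ℂ] H => T x) (h a ha)

lemma tendsto_π_apply {l : Filter (𝔅.E s)} (hl : l.IsApproximateUnit)
    (hb : ∀ᶠ u in l, ‖u‖ ≤ 1) {k : H} (hk : k ∈ 𝔅.essentialSpace π s) :
    Tendsto (fun u : 𝔅.E s => π u k) l (𝓝 k) := by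
  refine tendsto_apply_self_of_mem_closure (T := fun u : 𝔅.E s => π u) ?_ ?_ hk
  · filter_upwards [hb] with u hu
    exact (NonUnitalStarAlgHom.norm_apply_le π (u : A)).trans hu
  · intro h hh
    induction hh using Submodule.span_induction with
    | mem x hx =>
      obtain ⟨a, ha, h, rfl⟩ := hx
      have h1 : Tendsto (fun u : 𝔅.E s => (u : A) * a) l (𝓝 a) :=
        (continuous_subtype_val.tendsto _).comp (hl.tendsto_mul_right ⟨a, ha⟩)
      have h2 : Continuous fun b : A => π b h :=
        (ContinuousLinearMap.apply ℂ H h).continuous.comp (continuous_starHom π)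
      have h3 := (h2.tendsto a).comp h1
      simpa [Function.comp_def] using h3
    | zero => simpa using tendsto_const_nhds
    | add x y _ _ hx hy => simpa using hx.add hy
    | smul c x _ hx => simpa using hx.const_smul c

end EssentialSpace

variable {𝔅}

lemma integrated_δ (π : A →⋆ₙₐ[ℂ] (H →L[ℂ] H)) (ν : S →ₙ* (H →L[ℂ] H)) (s : S) (a : 𝔅.E s) :
    𝔅.integrated π ν (𝔅.δ s a) = π a * ν s := by
  rw [integrated, lift_δ]; rfl

/-! ### Integrated forms of covariant representations. -/

namespace IsCovariantRep

variable {π : A →⋆ₙₐ[ℂ] (H →L[ℂ] H)} {ν : S →ₙ* (H →L[ℂ] H)} (hc : 𝔅.IsCovariantRep π ν)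

include hc

lemma apply_mem (s : S) (h : H) : ν s h ∈ 𝔅.essentialSpace π s := by
  rw [← hc.finalSpace s]; exact ⟨h, rfl⟩

/-- As `ν f` is idempotent, `ν f h - h` lies in its kernel, which is orthogonal to the initial space
and so is killed by `π(E f)`. -/
lemma mul_idem {f : S} (hf : f * f = f) {a : A} (ha : a ∈ 𝔅.E f) : π a * ν f = π a := by
  ext h
  have hcl : IsClosed ((ν f).toLinearMap.ker : Set H) := (ν f).isClosed_ker
  have h1 : ν f h - h ∈ (ν f).toLinearMap.ker := by
    change ν f (ν f h - h) = 0
    rw [map_sub, sub_eq_zero]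
    change (ν f * ν f) h = ν f h
    rw [← map_mul, hf]
  have h2 := (ν f).toLinearMap.ker.le_orthogonal_orthogonal h1
  rw [hc.initialSpace, inv_of_idem hf] at h2
  have h3 := (mem_essentialSpace_orthogonal π).1 h2 a ha
  rw [map_sub, sub_eq_zero] at h3
  exact h3

/-- Multiply the covariance relation on the right by `ν s`; `π(c)` absorbs `ν (s⁻¹ s)`. -/
lemma mul_ν (s : S) (c : 𝔅.E s⁻¹) : π (𝔅.β s c : A) * ν s = ν s * π c := by
  rw [← hc.covariance, mul_assoc, ← map_mul, mul_assoc,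
    hc.mul_idem (inv_mul_idem s) (𝔅.mem_E_inv_mul c.2)]

lemma mul_ν_of_natLE {r t : S} (h : NatLE r t) {a : A} (ha : a ∈ 𝔅.E r) :
    π a * ν r = π a * ν t := by
  obtain ⟨f, hf, rfl⟩ := h
  have hat := 𝔅.E_mul_le t f ha
  have h1 := hc.mul_ν t ((𝔅.β t).symm ⟨a, hat⟩)
  rw [StarAlgEquiv.apply_symm_apply] at h1
  rw [map_mul, ← mul_assoc, h1, mul_assoc, hc.mul_idem hf (𝔅.symm_mem_of_mem_mul ha hat)]

lemma apply_eq_zero_of_mem_N {ρ : 𝔅.L →⋆ₙₐ[ℂ] (H →L[ℂ] H)}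
    (hρ : ∀ x : 𝔅.L, ρ x = 𝔅.integrated π ν x) (x : 𝔅.L) (hx : x ∈ 𝔅.N) : ρ x = 0 := by
  rw [← TwoSidedIdeal.mem_ker]
  refine TwoSidedIdeal.span_le.2 ?_ hx
  rintro _ ⟨r, t, h, a, ha, rfl⟩
  change _ ∈ TwoSidedIdeal.ker ρ
  rw [TwoSidedIdeal.mem_ker, map_sub, hρ, hρ, integrated_δ, integrated_δ,
    hc.mul_ν_of_natLE h ha, sub_self]

lemma tendsto_apply {ρ : 𝔅.L →⋆ₙₐ[ℂ] (H →L[ℂ] H)}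
    (hρ : ∀ x : 𝔅.L, ρ x = 𝔅.integrated π ν x) (s : S) {l : Filter (𝔅.E s)}
    (hl : l.IsApproximateUnit) (hb : ∀ᶠ u in l, ‖u‖ ≤ 1) (h : H) :
    Tendsto (fun u => ρ (𝔅.δ s u) h) l (𝓝 (ν s h)) := by
  simp only [hρ, integrated_δ]
  exact tendsto_π_apply π hl hb (hc.apply_mem s h)

end IsCovariantRep

end Covariant

/-! ### The covariant representation built from `ρ`. -/

section StrongLimit

attribute [local instance] nonUnitalCStarAlgebraE

variable {S A : Type*} [UnitalInverseSemigroup S] [NonUnitalCStarAlgebra A] {𝔅 : InvAction S A}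
  {H : Type*} [NormedAddCommGroup H] [InnerProductSpace ℂ H] [CompleteSpace H]
  (ρ : 𝔅.L →⋆ₙₐ[ℂ] (H →L[ℂ] H))

/-- The representation `a ↦ ρ(a δ₁)` of `A`. -/
noncomputable def coeffRep : A →⋆ₙₐ[ℂ] (H →L[ℂ] H) where
  toFun a := ρ (𝔅.δ 1 ⟨a, 𝔅.mem_one a⟩)
  map_smul' c a := by
    change _ = c • _
    rw [← map_smul, ← map_smul]; rfl
  map_zero' := by
    rw [← map_zero ρ, ← map_zero (𝔅.δ 1)]; rfl
  map_add' a b := by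
    rw [← map_add, ← map_add]; rfl
  map_mul' a b := by
    rw [← map_mul, δ_one_mul_δ]
  map_star' a := by
    -- The adjoint of `a δ_1` is `β_1⁻¹(a*) δ_{1⁻¹}`, and `β_1` is the identity.
    have h : ((𝔅.β 1).symm (star ⟨a, 𝔅.mem_one a⟩) : A) = star a := by
      rw [← 𝔅.β_idem (one_mul 1) _ (Subtype.prop _)]
      simp only [Subtype.coe_eta, StarAlgEquiv.apply_symm_apply]
      rfl
    have h' : (𝔅.β 1).symm (star ⟨a, 𝔅.mem_one a⟩) =
        ⟨star a, by rw [inv_of_idem (one_mul 1)]; exact 𝔅.mem_one _⟩ := Subtype.ext h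
    rw [← map_star, star_δ, h']
    exact congrArg ρ (𝔅.δ_congr (inv_of_idem (one_mul 1)) _ _).symm

lemma coeffRep_apply (a : A) : coeffRep ρ a = ρ (𝔅.δ 1 ⟨a, 𝔅.mem_one a⟩) := rfl

lemma coeffRep_mul (a : A) {s : S} (b : 𝔅.E s) :
    coeffRep ρ a * ρ (𝔅.δ s b) = ρ (𝔅.δ s ⟨a * b, (𝔅.ideal s).mul_mem_left a b.2⟩) := by
  rw [coeffRep_apply, ← map_mul, δ_one_mul_δ]

lemma mul_coeffRep {s : S} (a : 𝔅.E s) (b : 𝔅.E s⁻¹) :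
    ρ (𝔅.δ s a) * coeffRep ρ b = ρ (𝔅.δ s (a * 𝔅.β s b)) := by
  rw [coeffRep_apply, ← map_mul, δ_mul_δ_one]

variable {ρ} (hρ : ∀ x ∈ 𝔅.N, ρ x = 0)

section

include hρ

/-- The only direct use of vanishing on `N`: the generators with `t = 1` suffice for the whole
construction. -/
lemma map_δ_idem {f : S} (hf : f * f = f) (a : 𝔅.E f) : ρ (𝔅.δ f a) = coeffRep ρ a := by
  rw [coeffRep_apply, ← sub_eq_zero, ← map_sub]
  exact hρ _ (TwoSidedIdeal.subset_span ⟨f, 1, NatLE.one_of_idem hf, a, a.2, rfl⟩)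

lemma star_mul_map_δ {s : S} (a b : 𝔅.E s) :
    star (ρ (𝔅.δ s a)) * ρ (𝔅.δ s b) = coeffRep ρ ((𝔅.β s).symm (star a * b) : A) := by
  rw [← map_star, ← map_mul, star_δ_mul_δ, map_δ_idem hρ (inv_mul_idem s)]

lemma norm_map_δ_le {s : S} (a : 𝔅.E s) : ‖ρ (𝔅.δ s a)‖ ≤ ‖a‖ := by
  have h : ‖ρ (𝔅.δ s a)‖ * ‖ρ (𝔅.δ s a)‖ ≤ ‖a‖ * ‖a‖ := by
    rw [← CStarRing.norm_star_mul_self, star_mul_map_δ hρ]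
    refine (NonUnitalStarAlgHom.norm_apply_le (coeffRep ρ) _).trans ?_
    change ‖(𝔅.β s).symm (star a * a)‖ ≤ _
    rw [← 𝔅.norm_β, StarAlgEquiv.apply_symm_apply, CStarRing.norm_star_mul_self]
  exact abs_le_of_sq_le_sq' (by rwa [sq, sq]) (norm_nonneg _) |>.2

lemma continuous_map_δ (s : S) : Continuous fun a : 𝔅.E s => ρ (𝔅.δ s a) :=
  AddMonoidHomClass.continuous_of_bound
    ((ρ : 𝔅.L →+ (H →L[ℂ] H)).comp (𝔅.δ s).toAddMonoidHom) 1 fun a => by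
      rw [one_mul]; exact norm_map_δ_le hρ a

/-- `‖ρ(a δ_s) h‖² = ⟨h, π(β_s⁻¹(a* a)) h⟩`, and the coefficient lies in `E s⁻¹`. -/
lemma map_δ_apply_eq_zero {s : S} {h : H} (hh : h ∈ (𝔅.essentialSpace (coeffRep ρ) s⁻¹)ᗮ)
    (a : 𝔅.E s) : ρ (𝔅.δ s a) h = 0 := by
  rw [← inner_self_eq_zero (𝕜 := ℂ), ← ContinuousLinearMap.adjoint_inner_right,
    ← ContinuousLinearMap.star_eq_adjoint]
  change inner ℂ h ((star (ρ (𝔅.δ s a)) * ρ (𝔅.δ s a)) h) = 0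
  rw [star_mul_map_δ hρ, (mem_essentialSpace_orthogonal _).1 hh _ (Subtype.prop _),
    inner_zero_right]

end

/-- In a C⋆-algebra there is a contractive approximate unit. -/
lemma exists_isApproximateUnit (B : Type*) [NonUnitalCStarAlgebra B] :
    ∃ l : Filter B, l.IsApproximateUnit ∧ ∀ᶠ u in l, ‖u‖ ≤ 1 := by
  let _ : PartialOrder B := CStarAlgebra.spectralOrder B
  have : StarOrderedRing B := CStarAlgebra.spectralOrderedRing B
  have hl := CStarAlgebra.increasingApproximateUnit B
  exact ⟨_, hl.toIsApproximateUnit, hl.eventually_norm⟩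

section

variable {s : S} {l : Filter (𝔅.E s)} (hl : l.IsApproximateUnit)

include hρ hl

lemma tendsto_map_δ_coeffRep_apply (b : 𝔅.E s⁻¹) (h : H) :
    Tendsto (fun u => ρ (𝔅.δ s u) (coeffRep ρ b h)) l (𝓝 (ρ (𝔅.δ s (𝔅.β s b)) h)) := by
  have h1 : Continuous fun a : 𝔅.E s => ρ (𝔅.δ s a) h :=
    (ContinuousLinearMap.apply ℂ H h).continuous.comp (continuous_map_δ hρ s)
  refine ((h1.tendsto _).comp (hl.tendsto_mul_right (𝔅.β s b))).congr fun u => ?_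
  change ρ (𝔅.δ s (u * 𝔅.β s b)) h = (ρ (𝔅.δ s u) * coeffRep ρ b) h
  rw [mul_coeffRep]

/-- Split `h` along the essential space of `E s⁻¹`: the orthogonal part is killed, the rest follows
by density and contractivity. -/
lemma exists_tendsto_map_δ_apply (hb : ∀ᶠ u in l, ‖u‖ ≤ 1) (h : H) :
    ∃ k, Tendsto (fun u => ρ (𝔅.δ s u) h) l (𝓝 k) := by
  have := hl.neBot
  have hcl := isClosed_essentialSpace (𝔅 := 𝔅) (coeffRep ρ) (s := s⁻¹)
  have : CompleteSpace (𝔅.essentialSpace (coeffRep ρ) s⁻¹) := hcl.completeSpace_coe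
  obtain ⟨p, hp, q, hq, rfl⟩ :=
    (𝔅.essentialSpace (coeffRep ρ) s⁻¹).exists_add_mem_mem_orthogonal h
  have hk : ∃ k, Tendsto (fun u => ρ (𝔅.δ s u) p) l (𝓝 k) := by
    refine exists_tendsto_apply_of_mem_closure ?_ ?_ hp
    · filter_upwards [hb] with u hu using (norm_map_δ_le hρ u).trans hu
    · intro k hk
      induction hk using Submodule.span_induction with
      | mem x hx =>
        obtain ⟨b, hb, h, rfl⟩ := hx
        exact ⟨_, tendsto_map_δ_coeffRep_apply hρ hl ⟨b, hb⟩ h⟩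
      | zero => exact ⟨0, by simp⟩
      | add x y _ _ hx hy =>
        obtain ⟨a, ha⟩ := hx
        obtain ⟨b, hb⟩ := hy
        exact ⟨a + b, by simpa using ha.add hb⟩
      | smul c x _ hx =>
        obtain ⟨a, ha⟩ := hx
        exact ⟨c • a, by simpa using ha.const_smul c⟩
  obtain ⟨k, hk⟩ := hk
  refine ⟨k, hk.congr fun u => ?_⟩
  rw [map_add, map_δ_apply_eq_zero hρ hq, add_zero]

end

include hρ in
lemma exists_strongLimit (s : S) : ∃ (T : H →L[ℂ] H) (l : Filter (𝔅.E s)),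
    l.IsApproximateUnit ∧ ∀ h, Tendsto (fun u => ρ (𝔅.δ s u) h) l (𝓝 (T h)) := by
  obtain ⟨l, hl, hb⟩ := exists_isApproximateUnit (𝔅.E s)
  have := hl.neBot
  choose F hF using exists_tendsto_map_δ_apply hρ hl hb
  refine ⟨(linearMapOfTendsto F (fun u => (ρ (𝔅.δ s u)).toLinearMap)
    (tendsto_pi_nhds.2 hF)).mkContinuous 1 fun h => ?_, l, hl, hF⟩
  refine le_of_tendsto (hF h).norm ?_
  filter_upwards [hb] with u hu
  exact (ρ (𝔅.δ s u)).le_of_opNorm_le ((norm_map_δ_le hρ u).trans hu) h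

/-- The strong limit of `ρ(u δ_s)` along a contractive approximate unit of `E s`. -/
noncomputable def strongLimit (s : S) : H →L[ℂ] H := (exists_strongLimit hρ s).choose

lemma strongLimit_spec (s : S) : ∃ l : Filter (𝔅.E s), l.IsApproximateUnit ∧
    ∀ h, Tendsto (fun u => ρ (𝔅.δ s u) h) l (𝓝 (strongLimit hρ s h)) :=
  (exists_strongLimit hρ s).choose_spec

/-- Compute the limit of `ρ(a u δ_s) h = π(a) ρ(u δ_s) h` in two ways. -/
lemma map_δ (s : S) (a : 𝔅.E s) : ρ (𝔅.δ s a) = coeffRep ρ a * strongLimit hρ s := by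
  obtain ⟨l, hl, hT⟩ := strongLimit_spec hρ s
  have := hl.neBot
  ext h
  have h1 : Continuous fun a : 𝔅.E s => ρ (𝔅.δ s a) h :=
    (ContinuousLinearMap.apply ℂ H h).continuous.comp (continuous_map_δ hρ s)
  have h2 := (h1.tendsto _).comp (hl.tendsto_mul_left a)
  have h3 := ((coeffRep ρ a).continuous.tendsto _).comp (hT h)
  refine tendsto_nhds_unique (h2.congr fun u => ?_) h3
  change ρ (𝔅.δ s (a * u)) h = (coeffRep ρ a * ρ (𝔅.δ s u)) h
  rw [coeffRep_mul]; rfl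

lemma strongLimit_mul_coeffRep (s : S) (b : 𝔅.E s⁻¹) :
    strongLimit hρ s * coeffRep ρ b = ρ (𝔅.δ s (𝔅.β s b)) := by
  obtain ⟨l, hl, hT⟩ := strongLimit_spec hρ s
  have := hl.neBot
  ext h
  exact tendsto_nhds_unique (hT _) (tendsto_map_δ_coeffRep_apply hρ hl b h)

lemma strongLimit_apply_mem (s : S) (h : H) :
    strongLimit hρ s h ∈ 𝔅.essentialSpace (coeffRep ρ) s := by
  obtain ⟨l, hl, hT⟩ := strongLimit_spec hρ s
  have := hl.neBot
  refine (isClosed_essentialSpace _).mem_of_tendsto (hT h) (Eventually.of_forall fun u => ?_)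
  rw [map_δ hρ]
  exact apply_mem_essentialSpace _ u.2 _

lemma strongLimit_apply_eq_zero {s : S} {h : H}
    (hh : h ∈ (𝔅.essentialSpace (coeffRep ρ) s⁻¹)ᗮ) : strongLimit hρ s h = 0 := by
  obtain ⟨l, hl, hT⟩ := strongLimit_spec hρ s
  have := hl.neBot
  refine tendsto_nhds_unique (hT h) (tendsto_const_nhds.congr fun u => ?_)
  rw [map_δ_apply_eq_zero hρ hh]

/-- An iterated limit of `ρ(v δ_r) ρ(u δ_s) h`, where each product has its coefficient in `E (r s)`.
-/
lemma strongLimit_mul_apply_mem (r s : S) (h : H) :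
    (strongLimit hρ r * strongLimit hρ s) h ∈ 𝔅.essentialSpace (coeffRep ρ) (r * s) := by
  obtain ⟨l, hl, hT⟩ := strongLimit_spec hρ s
  obtain ⟨m, hm, hT'⟩ := strongLimit_spec hρ r
  have := hl.neBot
  have := hm.neBot
  refine (isClosed_essentialSpace _).mem_of_tendsto
    (((strongLimit hρ r).continuous.tendsto _).comp (hT h)) (Eventually.of_forall fun u => ?_)
  refine (isClosed_essentialSpace _).mem_of_tendsto (hT' _) (Eventually.of_forall fun v => ?_)
  change (ρ (𝔅.δ r v) * ρ (𝔅.δ s u)) h ∈ _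
  rw [← map_mul, δ_mul_δ, map_δ hρ]
  exact apply_mem_essentialSpace _ (Subtype.prop _) _

lemma strongLimit_mul (r s : S) :
    strongLimit hρ (r * s) = strongLimit hρ r * strongLimit hρ s := by
  refine ext_of_essentialSpace (coeffRep ρ) (strongLimit_apply_mem hρ _)
    (strongLimit_mul_apply_mem hρ r s) fun a ha => ?_
  have har := 𝔅.E_mul_le r s ha
  obtain ⟨l, hl, hT⟩ := strongLimit_spec hρ s
  have := hl.neBot
  rw [← mul_assoc, ← map_δ hρ (r * s) ⟨a, ha⟩, ← map_δ hρ r ⟨a, har⟩]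
  ext h
  refine tendsto_nhds_unique ?_
    (((ρ (𝔅.δ r ⟨a, har⟩)).continuous.tendsto _).comp (hT h))
  -- Since `β_r⁻¹(a)` lies in `E s`, the approximate unit of `E s` acts on it, and the coefficients
  -- `β_r(β_r⁻¹(a) u)` tend to `a`.
  have hc := 𝔅.symm_mem_of_mem_mul ha har
  have h1 : Continuous fun a : 𝔅.E (r * s) => ρ (𝔅.δ (r * s) a) h :=
    (ContinuousLinearMap.apply ℂ H h).continuous.comp (continuous_map_δ hρ _)
  have h2 : Tendsto (fun u => 𝔅.mulCoeff r s ⟨a, har⟩ u) l (𝓝 ⟨a, ha⟩) := by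
    rw [tendsto_subtype_rng]
    have h3 : Tendsto (fun u : 𝔅.E s => (⟨((𝔅.β r).symm ⟨a, har⟩ : A) * u,
        𝔅.mul_mem_E r⁻¹ (Subtype.prop _) _⟩ : 𝔅.E r⁻¹)) l (𝓝 ((𝔅.β r).symm ⟨a, har⟩)) := by
      rw [tendsto_subtype_rng]
      exact (continuous_subtype_val.tendsto (⟨_, hc⟩ : 𝔅.E s)).comp (hl.tendsto_mul_left ⟨_, hc⟩)
    have h4 := ((continuous_subtype_val.comp (𝔅.continuous_β r)).tendsto _).comp h3
    simp only [Function.comp_apply, StarAlgEquiv.apply_symm_apply] at h4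
    exact h4
  refine ((h1.tendsto _).comp h2).congr fun u => ?_
  change _ = (ρ (𝔅.δ r ⟨a, har⟩) * ρ (𝔅.δ s u)) h
  rw [← map_mul, δ_mul_δ]; rfl

/-- `s ↦ strongLimit hρ s` as a multiplicative map. -/
noncomputable def strongLimitHom : S →ₙ* (H →L[ℂ] H) where
  toFun := strongLimit hρ
  map_mul' := strongLimit_mul hρ

/-- The adjoint of `ν_s π(a*) = ρ(β_s(a*) δ_s)` is `π(a) ν_s* = ρ(a δ_{s⁻¹})`, which equals `π(a)
ν_{s⁻¹}`. -/
lemma star_strongLimit (s : S) : star (strongLimit hρ s) = strongLimit hρ s⁻¹ := by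
  refine ext_of_essentialSpace (coeffRep ρ) (s := s⁻¹) (fun h => ?_)
    (strongLimit_apply_mem hρ _) fun a ha => ?_
  · have hcl := isClosed_essentialSpace (𝔅 := 𝔅) (coeffRep ρ) (s := s⁻¹)
    have : CompleteSpace (𝔅.essentialSpace (coeffRep ρ) s⁻¹) := hcl.completeSpace_coe
    rw [← (𝔅.essentialSpace (coeffRep ρ) s⁻¹).orthogonal_orthogonal, Submodule.mem_orthogonal]
    intro u hu
    rw [ContinuousLinearMap.star_eq_adjoint, ContinuousLinearMap.adjoint_inner_right,
      strongLimit_apply_eq_zero hρ hu, inner_zero_left]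
  · have h1 := strongLimit_mul_coeffRep hρ s (star ⟨a, ha⟩)
    have h2 := congrArg star h1
    have h3 : star (coeffRep ρ (star ⟨a, ha⟩ : 𝔅.E s⁻¹)) = coeffRep ρ a := by
      rw [← map_star]; exact congrArg _ (star_star a)
    rw [star_mul, h3] at h2
    rw [h2, ← map_δ hρ s⁻¹ ⟨a, ha⟩, ← map_star, star_δ, map_star,
      StarAlgEquiv.symm_apply_apply, star_star]

lemma strongLimit_apply_of_idem {f : S} (hf : f * f = f) {k : H}
    (hk : k ∈ 𝔅.essentialSpace (coeffRep ρ) f) : strongLimit hρ f k = k := by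
  refine essentialSpace_le (coeffRep ρ)
    (K := (strongLimit hρ f - 1).toLinearMap.ker) (strongLimit hρ f - 1).isClosed_ker
    (fun a ha h => ?_) hk |> sub_eq_zero.1
  have ha' : a ∈ 𝔅.E f⁻¹ := by rwa [inv_of_idem hf]
  refine sub_eq_zero.2 ?_
  change (strongLimit hρ f * coeffRep ρ a) h = coeffRep ρ a h
  rw [strongLimit_mul_coeffRep hρ f ⟨a, ha'⟩, map_δ_idem hρ hf, 𝔅.β_idem hf]

/-- Surjectivity: `ν_s ν_{s⁻¹} = ν_{s s⁻¹}` fixes the essential space, so `k = ν_s (ν_{s⁻¹} k)`. -/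
lemma range_strongLimit (s : S) :
    (strongLimit hρ s).toLinearMap.range = 𝔅.essentialSpace (coeffRep ρ) s := by
  refine le_antisymm (by rintro _ ⟨h, rfl⟩; exact strongLimit_apply_mem hρ s h) fun k hk => ?_
  have h1 : k ∈ 𝔅.essentialSpace (coeffRep ρ) (s * s⁻¹) :=
    essentialSpace_le (𝔅 := 𝔅) (coeffRep ρ) (isClosed_essentialSpace _)
      (fun a ha h => apply_mem_essentialSpace _ (𝔅.mem_E_mul_inv ha) h) hk
  have h2 := strongLimit_apply_of_idem hρ (mul_inv_idem s) h1
  rw [strongLimit_mul] at h2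
  exact ⟨strongLimit hρ s⁻¹ k, h2⟩

lemma isCovariantRep_strongLimitHom : 𝔅.IsCovariantRep (coeffRep ρ) (strongLimitHom hρ) where
  partialIsometry s := by
    change strongLimit hρ s * star (strongLimit hρ s) * strongLimit hρ s = strongLimit hρ s
    rw [star_strongLimit, ← strongLimit_mul, ← strongLimit_mul, mul_inv_mul]
  covariance s a := by
    change strongLimit hρ s * _ * strongLimit hρ s⁻¹ = _
    have ha := 𝔅.mem_E_mul_inv (𝔅.β s a).2
    rw [strongLimit_mul_coeffRep, map_δ hρ, mul_assoc, ← strongLimit_mul,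
      ← map_δ hρ (s * s⁻¹) ⟨_, ha⟩, map_δ_idem hρ (mul_inv_idem s)]
  initialSpace s := by
    change (strongLimit hρ s).toLinearMap.kerᗮ = _
    have hcl := isClosed_essentialSpace (𝔅 := 𝔅) (coeffRep ρ) (s := s⁻¹)
    have : CompleteSpace (𝔅.essentialSpace (coeffRep ρ) s⁻¹) := hcl.completeSpace_coe
    -- The essential space of `E s⁻¹` is the range of `ν_{s⁻¹} = ν_s*`, whose complement is `ker
    -- ν_s`.
    rw [← (𝔅.essentialSpace (coeffRep ρ) s⁻¹).orthogonal_orthogonal, ← range_strongLimit hρ,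
      ← star_strongLimit, ContinuousLinearMap.star_eq_adjoint,
      ContinuousLinearMap.orthogonal_range, ContinuousLinearMap.adjoint_adjoint]
  finalSpace := range_strongLimit hρ

lemma map_eq_integrated (x : 𝔅.L) :
    ρ x = 𝔅.integrated (coeffRep ρ) (strongLimitHom hρ) x := by
  classical
  refine DirectSum.induction_on (β := fun s => 𝔅.E s) x ?_ (fun s a => ?_) fun x y hx hy => ?_
  · exact (map_zero ρ).trans (map_zero (𝔅.integrated _ _)).symm
  · refine Eq.trans ?_ (integrated_δ (coeffRep ρ) (strongLimitHom hρ) s a).symm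
    convert! map_δ hρ s a
  · exact (map_add ρ x y).trans
      ((congrArg₂ (· + ·) hx hy).trans (map_add (𝔅.integrated _ _) x y).symm)

end StrongLimit

end InvAction

theorem theorem5p6 {S A H : Type*} [UnitalInverseSemigroup S] [NonUnitalCStarAlgebra A]
    [NormedAddCommGroup H] [InnerProductSpace ℂ H] [CompleteSpace H]
    (𝔅 : InvAction S A) (ρ : 𝔅.L →⋆ₙₐ[ℂ] (H →L[ℂ] H)) :
    ((∀ x ∈ 𝔅.N, ρ x = 0) ↔
      ∃ (π : A →⋆ₙₐ[ℂ] (H →L[ℂ] H)) (ν : S →ₙ* (H →L[ℂ] H)),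
        𝔅.IsCovariantRep π ν ∧ ∀ x : 𝔅.L, ρ x = 𝔅.integrated π ν x) ∧
    ∀ (π : A →⋆ₙₐ[ℂ] (H →L[ℂ] H)) (ν : S →ₙ* (H →L[ℂ] H)),
      𝔅.IsCovariantRep π ν → (∀ x : 𝔅.L, ρ x = 𝔅.integrated π ν x) →
        (∀ a : A, π a = ρ (𝔅.δ 1 ⟨a, 𝔅.mem_one a⟩)) ∧
        ∀ (s : S) (l : Filter (𝔅.E s)), l.IsApproximateUnit → (∀ᶠ u in l, ‖u‖ ≤ 1) →
          ∀ h : H, Tendsto (fun u => ρ (𝔅.δ s u) h) l (𝓝 (ν s h)) := by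
  refine ⟨⟨fun hρ => ⟨_, _, InvAction.isCovariantRep_strongLimitHom hρ, InvAction.map_eq_integrated hρ⟩, ?_⟩, ?_⟩
  · rintro ⟨π, ν, hc, hρ⟩
    exact hc.apply_eq_zero_of_mem_N hρ
  · intro π ν hc hρ
    refine ⟨fun a => ?_, fun s l hl hb => hc.tendsto_apply hρ s hl hb⟩
    -- `ρ(a δ_1) = π(a) ν_1`, and `ν_1` is absorbed because `E 1 = A`.
    rw [hρ, InvAction.integrated_δ, hc.mul_idem (one_mul 1) (𝔅.mem_one a)]
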